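/- Anonymous bandits. There are $N$ users, $K$ arms and a minimum group size $C$. An instance consists of 1-subgaussian reward distributions $\mathcal D_{i,j}$ on $\mathbb R$ with means $\mu_{i,j}\in[0,1]$, one for each user $i$ and arm $j$. In each round a learning algorithm assigns every user to an arm and partitions a subset of the users into groups of size at least $C$, where all users in a group play the same arm in that round. If user $i$ plays arm $j$, the user receives a reward drawn from $\mathcal D_{i,j}$, independently over users and rounds; the learner observes only the total reward of each group. The learner may be randomized, and its choices in a round may depend on its internal randomness and on all feedback from earlier rounds. If $r_{i,t}$ is the reward of user $i$ in round $t$, the regret over $T$ rounds is $$\mathbf{Reg}_T = T\sum_{i=1}^{N}\max_{j}\mu_{i,j}-\mathbb E\Big[\sum_{t=1}^{T}\sum_{i=1}^{N} r_{i,t}\Big].$$ Theorem. Let $N=K=3$ and $C=2$ (so $N=C+1$). There is an absolute constant $c>0$ such that for every $T\ge 1$ there are two instances $I_0,I_1$ (depending on $T$), all of whose reward distributions are Bernoulli, such that every learning algorithm (which may depend on $T$, $I_0$ and $I_1$) satisfies $$\tfrac12\big(\mathbf{Reg}_T(I_0)+\mathbf{Reg}_T(I_1)\big)\ \ge\ c\,T^{2/3},$$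 that is, its expected regret on an instance drawn uniformly at random from $\{I_0,I_1\}$ is at least $c\,T^{2/3}$. In particular, every learning algorithm has regret at least $c\,T^{2/3}$ on at least one of the two instances. -/

import Mathlib

open MeasureTheory ProbabilityTheory

noncomputable section

namespace AnonymousBandit

/-- A problem instance with `N` users and `K` arms: for each user `i` and arm `j` a 1-subgaussian
reward distribution on `ℝ` with mean in `[0, 1]`. -/
structure Instance (N K : ℕ) where
  /-- the reward distribution of user `i` on arm `j` -/
  law : Fin N → Fin K → Measure ℝ
  isProb : ∀ i j, IsProbabilityMeasure (law i j)
  subgaussian : ∀ i j, HasSubgaussianMGF (fun x => x - ∫ y, y ∂(law i j)) 1 (law i j)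
  mean_mem : ∀ i j, (∫ x, x ∂(law i j)) ∈ Set.Icc (0 : ℝ) 1

/-- The mean reward of user `i` on arm `j`. -/
def Instance.mean {N K : ℕ} (I : Instance N K) (i : Fin N) (j : Fin K) : ℝ :=
  ∫ x, x ∂(I.law i j)

/-- What the learner does in one round: an assignment of all users to arms, and a collection of
pairwise disjoint groups of users (not necessarily covering all users), each of size at least `C`
and such that all users in a group play the same arm. -/
structure Action (N K C : ℕ) where
  /-- the arm played by each user -/
  arm : Fin N → Fin K
  /-- the groups whose total reward is reported -/
  groups : Finset (Finset (Fin N))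
  disjoint : ∀ G ∈ groups, ∀ H ∈ groups, G ≠ H → Disjoint G H
  le_card : ∀ G ∈ groups, C ≤ G.card
  same_arm : ∀ G ∈ groups, ∀ i ∈ G, ∀ i' ∈ G, arm i = arm i'

/-- There are finitely many actions; every set of actions is measurable. -/
instance Action.instMeasurableSpace (N K C : ℕ) : MeasurableSpace (Action N K C) := ⊤

/-- The feedback of one round: a real number for each group of users (and the uninformative value
`0` for each set of users that is not one of the groups). -/
abbrev Feedback (N : ℕ) : Type := Finset (Fin N) → ℝ

/-- The feedback for the action `a` when the reward of user `i` on arm `j` is `r i j`: the total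
reward of each group. -/
def Action.observe {N K C : ℕ} (a : Action N K C) (r : Fin N → Fin K → ℝ) : Feedback N :=
  open scoped Classical in
  fun G => if G ∈ a.groups then ∑ i ∈ G, r i (a.arm i) else 0

/-- A learning algorithm for the anonymous bandits problem, possibly randomized: it first draws a
seed from a probability space of its own, and chooses its action in each round as a measurable
function of the seed and of the feedback received in all earlier rounds. (Its own earlier actions
are determined by these data.) -/
structure Learner (N K C : ℕ) where
  /-- the space of seeds -/
  Seed : Type
  measurableSpaceSeed : MeasurableSpace Seed
  /-- the distribution of the seed -/
  seedLaw : Measure Seed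
  isProb : IsProbabilityMeasure seedLaw
  /-- the action in round `t = 0, 1, 2, …` -/
  act : (t : ℕ) → Seed → (Fin t → Feedback N) → Action N K C
  measurable_act : ∀ t : ℕ, Measurable fun p : Seed × (Fin t → Feedback N) => act t p.1 p.2

attribute [instance] Instance.isProb Learner.measurableSpaceSeed Learner.isProb

/-- The reward tables: `ρ t i j` is the reward that user `i` gets in round `t` when playing
arm `j`. -/
abbrev RewardTable (N K : ℕ) : Type := ℕ → Fin N → Fin K → ℝ

/-- All the rewards `ρ t i j` are independent, and `ρ t i j` has the law of user `i` and arm `j`. -/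
def Instance.tableLaw {N K : ℕ} (I : Instance N K) : Measure (RewardTable N K) :=
  Measure.infinitePi fun _ : ℕ => Measure.pi fun i => Measure.pi fun j => I.law i j

/-- The feedback received in the first `t` rounds, for the seed `ω` and the reward table `ρ`. -/
def Learner.history {N K C : ℕ} (L : Learner N K C) (ω : L.Seed) (ρ : RewardTable N K) :
    (t : ℕ) → (Fin t → Feedback N)
  | 0 => Fin.elim0
  | t + 1 =>
    Fin.snoc (α := fun _ => Feedback N) (L.history ω ρ t)
      ((L.act t ω (L.history ω ρ t)).observe (ρ t))

/-- The action that the learner takes in round `t`. -/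
def Learner.action {N K C : ℕ} (L : Learner N K C) (ω : L.Seed) (ρ : RewardTable N K) (t : ℕ) :
    Action N K C :=
  L.act t ω (L.history ω ρ t)

/-- The reward received by user `i` in round `t`. -/
def Learner.reward {N K C : ℕ} (L : Learner N K C) (ω : L.Seed) (ρ : RewardTable N K) (t : ℕ)
    (i : Fin N) : ℝ :=
  ρ t i ((L.action ω ρ t).arm i)

/-- The overall expected regret over `T` rounds. -/
def regret {N K C : ℕ} (L : Learner N K C) (I : Instance N K) (T : ℕ) : ℝ :=
  (T : ℝ) * (∑ i, ⨆ j, I.mean i j) -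
    ∫ p : L.Seed × RewardTable N K, ∑ t ∈ Finset.range T, ∑ i, L.reward p.1 p.2 t i
      ∂(L.seedLaw.prod I.tableLaw)

end AnonymousBandit

end

open MeasureTheory ProbabilityTheory
open scoped NNReal ENNReal

namespace AnonymousBandit

/-! ### Product of finite sums of Dirac measures -/

/-! In the hard instances `hardMean (±ε)`, users 0 and 1 have means `1/2 ± ε` and `1/2 ∓ ε` on arm 0
and `1/2` on arm 1, while user 2 loses 1 on arm 0. Groups have at least two members, so without user
2 the only group on arm 0 is `{0, 1}`, whose total has the same law for both signs
(`sum_weight_neg_comp_observe`). Such a round teaches nothing, yet user 0's choice between arm 0 and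
the rest costs `ε` under one of the signs. Learning the sign costs 1 per round and takes about `ε⁻²`
rounds; with `ε` of order `T ^ (-1/3)`, both that price and the cost `T * ε` of ignorance are of
order `T ^ (2/3)`.

The rigorous form is a backward induction, `le_value_add_value`. With `n` rounds left and
nonnegative weights `a`, `b` on the two instances (unnormalised posteriors), the weighted remaining
cost is at least `n * ε * (√(a * b) - (a + b) / 4)`. Uninformative rounds keep `a`, `b` fixed;
informative ones shrink the expected `√(a * b)` by at most the factor `1 - 4 * ε ^ 2`. The measure
theory serves to express the regret through the finite recursion `Learner.value`
(`regret_eq_integral_value`). -/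

lemma pi_sum_smul_dirac {ι β : Type*} [Fintype ι] [DecidableEq ι] [Fintype β]
    {X : ι → Type*} [∀ i, MeasurableSpace (X i)] (w : ι → β → ℝ≥0) (g : ∀ i, β → X i) :
    Measure.pi (fun i => ∑ b, w i b • Measure.dirac (g i b)) =
      ∑ u : ι → β, (∏ i, w i (u i)) • Measure.dirac (fun i => g i (u i)) := by
  refine Measure.pi_eq fun s hs => ?_
  have h1 : ∀ i, (∑ b, w i b • Measure.dirac (g i b)) (s i) =
      ∑ b, (w i b : ℝ≥0∞) * (s i).indicator 1 (g i b) := by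
    intro i
    rw [Measure.finsetSum_apply]
    refine Finset.sum_congr rfl fun b _ => ?_
    rw [Measure.smul_apply, Measure.dirac_apply' _ (hs i)]
    rfl
  simp only [h1]
  rw [Finset.prod_univ_sum, Measure.finsetSum_apply, Fintype.piFinset_univ]
  refine Finset.sum_congr rfl fun u _ => ?_
  rw [Measure.smul_apply, Measure.dirac_apply' _ (MeasurableSet.univ_pi hs), Finset.prod_mul_distrib]
  have h2 : (Set.univ.pi s).indicator (1 : (∀ i, X i) → ℝ≥0∞) (fun i => g i (u i)) =
      ∏ i, (s i).indicator 1 (g i (u i)) := by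
    by_cases h : ∀ i, g i (u i) ∈ s i
    · rw [Set.indicator_of_mem (by simpa using h)]
      simp [Set.indicator_of_mem (h _)]
    · rw [Set.indicator_of_notMem (by simpa using h)]
      push Not at h
      obtain ⟨i, hi⟩ := h
      exact (Finset.prod_eq_zero (Finset.mem_univ i) (by simp [hi])).symm
  rw [h2, ← ENNReal.ofNNReal_finsetProd]
  rfl

/-! ### Bernoulli instances -/

lemma integral_bernoulli_id (p : unitInterval) :
    ∫ x, x ∂(bernoulliMeasure (1 : ℝ) 0 p) = p := by
  simp [integral_bernoulliMeasure]

/-- The instance in which the reward of user `i` on arm `j` is Bernoulli with mean `p i j`. -/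
noncomputable def bernoulliInstance {N K : ℕ} (p : Fin N → Fin K → unitInterval) :
    Instance N K where
  law i j := bernoulliMeasure 1 0 (p i j)
  isProb _ _ := inferInstance
  subgaussian i j := by
    have hm : ∀ᵐ x ∂(bernoulliMeasure (1 : ℝ) 0 (p i j)), x ∈ Set.Icc (0 : ℝ) 1 := by
      rw [ae_iff, ← Set.compl_ofPred, Set.ofPred_mem_eq]
      exact bernoulliMeasure_apply_of_notMem_of_notMem _ measurableSet_Icc.compl
        (by simp) (by simp)
    -- Hoeffding's lemma on `[0, 1]` gives the parameter `1/4`, which is below the required 1.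
    have h := hasSubgaussianMGF_of_mem_Icc (X := fun x : ℝ => x) aemeasurable_id hm
    refine ⟨h.integrable_exp_mul, fun t => (h.mgf_le t).trans (Real.exp_le_exp.2 ?_)⟩
    have : (0 : ℝ) ≤ t ^ 2 := sq_nonneg t
    norm_num
    nlinarith
  mean_mem i j := by
    rw [integral_bernoulli_id]
    exact (p i j).2

lemma mean_bernoulliInstance {N K : ℕ} (p : Fin N → Fin K → unitInterval) (i : Fin N)
    (j : Fin K) : (bernoulliInstance p).mean i j = p i j :=
  integral_bernoulli_id _

/-- The rewards of all users on all arms in one round. -/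
noncomputable def Instance.roundLaw {N K : ℕ} (I : Instance N K) :
    Measure (Fin N → Fin K → ℝ) :=
  Measure.pi fun i => Measure.pi fun j => I.law i j

instance {N K : ℕ} (I : Instance N K) : IsProbabilityMeasure I.roundLaw := by
  unfold Instance.roundLaw; infer_instance

instance {N K : ℕ} (I : Instance N K) : IsProbabilityMeasure I.tableLaw := by
  unfold Instance.tableLaw; infer_instance

/-- The probability of the pattern `U` of successes when the success probabilities are `m i j`. -/
noncomputable def weight {N K : ℕ} (m : Fin N → Fin K → ℝ) (U : Fin N → Fin K → Bool) : ℝ :=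
  ∏ i, ∏ j, if U i j then m i j else 1 - m i j

/-- The rewards for a pattern of successes. -/
def table {N K : ℕ} (U : Fin N → Fin K → Bool) (i : Fin N) (j : Fin K) : ℝ :=
  if U i j then 1 else 0

lemma weight_nonneg {N K : ℕ} (p : Fin N → Fin K → unitInterval) (U : Fin N → Fin K → Bool) :
    0 ≤ weight (fun i j => (p i j : ℝ)) U := by
  refine Finset.prod_nonneg fun i _ => Finset.prod_nonneg fun j _ => ?_
  split_ifs
  · exact (p i j).2.1
  · linarith [(p i j).2.2]

lemma roundLaw_bernoulliInstance {N K : ℕ} (p : Fin N → Fin K → unitInterval) :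
    (bernoulliInstance p).roundLaw =
      ∑ U : Fin N → Fin K → Bool,
        (weight (fun i j => (p i j : ℝ)) U).toNNReal • Measure.dirac (table U) := by
  have h0 : ∀ i j, (bernoulliInstance p).law i j = ∑ b : Bool,
      (if b then unitInterval.toNNReal (p i j)
        else unitInterval.toNNReal (unitInterval.symm (p i j))) •
        Measure.dirac (if b then (1 : ℝ) else 0) := by
    intro i j
    simp [bernoulliInstance, bernoulliMeasure_def]
  unfold Instance.roundLaw
  simp only [h0]
  simp only [pi_sum_smul_dirac (β := Bool)]
  rw [pi_sum_smul_dirac]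
  refine Finset.sum_congr rfl fun U _ => ?_
  congr 1
  apply NNReal.coe_injective
  rw [Real.coe_toNNReal _ (weight_nonneg p U)]
  push_cast
  refine Finset.prod_congr rfl fun i _ => Finset.prod_congr rfl fun j _ => ?_
  split_ifs <;> simp

/-- The law is a finite combination of point masses, so `f` need not be measurable. -/
lemma integrable_roundLaw {N K : ℕ} (p : Fin N → Fin K → unitInterval)
    (f : (Fin N → Fin K → ℝ) → ℝ) : Integrable f (bernoulliInstance p).roundLaw := by
  rw [roundLaw_bernoulliInstance, integrable_finsetSum_measure]
  intro U _
  exact (integrable_dirac (by simp)).smul_measure_nnreal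

lemma integral_roundLaw {N K : ℕ} (p : Fin N → Fin K → unitInterval)
    (f : (Fin N → Fin K → ℝ) → ℝ) :
    ∫ r, f r ∂(bernoulliInstance p).roundLaw =
      ∑ U, weight (fun i j => (p i j : ℝ)) U * f (table U) := by
  rw [roundLaw_bernoulliInstance, integral_finsetSum_measure]
  · refine Finset.sum_congr rfl fun U _ => ?_
    rw [integral_smul_nnreal_measure, integral_dirac, NNReal.smul_def,
      Real.coe_toNNReal _ (weight_nonneg p U), smul_eq_mul]
  · intro U _
    exact (integrable_dirac (by simp)).smul_measure_nnreal

lemma sum_weight {N K : ℕ} (p : Fin N → Fin K → unitInterval) :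
    ∑ U, weight (fun i j => (p i j : ℝ)) U = 1 := by
  have h := integral_roundLaw p fun _ => 1
  simpa using h.symm

lemma integral_roundLaw_eval {N K : ℕ} (I : Instance N K) (i : Fin N) (j : Fin K) :
    ∫ r, r i j ∂I.roundLaw = I.mean i j := by
  have h1 : MeasurePreserving (fun r : Fin N → Fin K → ℝ => r i) I.roundLaw
      (Measure.pi fun j => I.law i j) :=
    measurePreserving_eval (fun i => Measure.pi fun j => I.law i j) i
  have h2 : MeasurePreserving (fun r : Fin K → ℝ => r j) (Measure.pi fun j => I.law i j)
      (I.law i j) := measurePreserving_eval (fun j => I.law i j) j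
  have h := h2.comp h1
  rw [Instance.mean, ← h.map_eq]
  exact (integral_map (f := fun x : ℝ => x) h.measurable.aemeasurable
    aestronglyMeasurable_id).symm

/-! ### Measurability and independence -/

instance {N K C : ℕ} : Finite (Action N K C) :=
  Finite.of_injective (fun a : Action N K C => (a.arm, a.groups)) <| by
    rintro ⟨⟩ ⟨⟩ h
    simpa using h

instance {N K C : ℕ} : MeasurableSingletonClass (Action N K C) := ⟨fun _ => trivial⟩

lemma measurable_observe {N K C : ℕ} :
    Measurable fun q : Action N K C × (Fin N → Fin K → ℝ) => q.1.observe q.2 := by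
  refine measurable_from_prod_countable_right fun a => ?_
  refine measurable_pi_iff.2 fun G => ?_
  unfold Action.observe
  by_cases h : G ∈ a.groups
  · simp only [h, if_true]
    fun_prop
  · simp only [h, if_false]
    fun_prop

lemma measurable_snoc {α : Type*} [MeasurableSpace α] (t : ℕ) :
    Measurable fun q : (Fin t → α) × α => Fin.snoc (α := fun _ => α) q.1 q.2 := by
  refine measurable_pi_iff.2 fun k => ?_
  refine Fin.lastCases ?_ (fun k => ?_) k
  · simpa using measurable_snd
  · simpa [Function.comp_def] using
      (measurable_pi_apply k).comp (measurable_fst : Measurable fun q : (Fin t → α) × α => q.1)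

section

variable {N K C : ℕ} (L : Learner N K C)

lemma Learner.measurable_history (t : ℕ) :
    Measurable fun q : L.Seed × RewardTable N K => L.history q.1 q.2 t := by
  induction t with
  | zero => exact measurable_const
  | succ t ih =>
    have h : Measurable fun q : L.Seed × RewardTable N K => L.act t q.1 (L.history q.1 q.2 t) :=
      (L.measurable_act t).comp (measurable_fst.prodMk ih)
    exact (measurable_snoc t).comp (ih.prodMk (measurable_observe.comp
      (h.prodMk ((measurable_pi_apply t).comp measurable_snd))))

lemma Learner.measurable_history_right (ω : L.Seed) (t : ℕ) :
    Measurable fun ρ : RewardTable N K => L.history ω ρ t :=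
  (L.measurable_history t).comp measurable_prodMk_left

lemma Learner.measurable_action (t : ℕ) :
    Measurable fun q : L.Seed × RewardTable N K => L.action q.1 q.2 t :=
  (L.measurable_act t).comp (measurable_fst.prodMk (L.measurable_history t))

lemma Learner.history_congr (ω : L.Seed) {ρ ρ' : RewardTable N K} {t : ℕ}
    (h : ∀ s < t, ρ s = ρ' s) : L.history ω ρ t = L.history ω ρ' t := by
  induction t with
  | zero => rfl
  | succ t ih =>
    simp only [Learner.history]
    rw [ih fun s hs => h s (hs.trans t.lt_succ_self), h t t.lt_succ_self]

lemma Learner.indepFun_history (I : Instance N K) (ω : L.Seed) (t : ℕ) :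
    IndepFun (fun ρ => L.history ω ρ t) (fun ρ => ρ t) I.tableLaw := by
  have h : iIndepFun (fun (s : ℕ) (ρ : RewardTable N K) => ρ s) I.tableLaw :=
    iIndepFun_infinitePi (P := fun _ : ℕ => I.roundLaw) (X := fun _ r => r)
      fun _ => measurable_id
  have h2 := h.indepFun_finset (Finset.range t) {t} (by simp) fun _ => measurable_pi_apply _
  -- Rounds from `t` on are filled with 0; by `history_congr` the history does not read them, so it
  -- factors through the first `t` rounds.
  let ext : ({s // s ∈ Finset.range t} → Fin N → Fin K → ℝ) → RewardTable N K :=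
    fun x s => if hs : s ∈ Finset.range t then x ⟨s, hs⟩ else 0
  have hext : Measurable ext := by
    refine measurable_pi_iff.2 fun s => ?_
    by_cases hs : s ∈ Finset.range t
    · simp only [ext, hs, dif_pos]
      exact measurable_pi_apply _
    · simp only [ext, hs, dif_neg, not_false_eq_true]
      exact measurable_const
  have h3 := h2.comp ((L.measurable_history_right ω t).comp hext)
    (measurable_pi_apply (⟨t, by simp⟩ : ({t} : Finset ℕ)))
  have h4 : (fun ρ : RewardTable N K => L.history ω ρ t) =
      ((fun ρ => L.history ω ρ t) ∘ ext) ∘ fun ρ s => ρ s := by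
    funext ρ
    refine L.history_congr ω fun s hs => ?_
    simp [ext, hs]
  rw [h4]
  exact h3

lemma Instance.measurePreserving_round (I : Instance N K) (t : ℕ) :
    MeasurePreserving (fun ρ : RewardTable N K => ρ t) I.tableLaw I.roundLaw :=
  measurePreserving_eval_infinitePi (fun _ : ℕ => I.roundLaw) t

/-- Conditioning on the history: the current rewards are averaged out. -/
lemma Learner.integral_history_round (I : Instance N K) (ω : L.Seed) (t : ℕ)
    {G : (Fin t → Feedback N) → (Fin N → Fin K → ℝ) → ℝ}
    (hG : Measurable (Function.uncurry G)) {B : (Fin N → Fin K → ℝ) → ℝ}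
    (hB : Integrable B I.roundLaw) (hGB : ∀ h r, |G h r| ≤ B r) :
    ∫ ρ, G (L.history ω ρ t) (ρ t) ∂I.tableLaw =
      ∫ ρ, ∫ r, G (L.history ω ρ t) r ∂I.roundLaw ∂I.tableLaw := by
  have hH := L.measurable_history_right ω t
  have hmap := (indepFun_iff_map_prod_eq_prod_map_map hH.aemeasurable
    (measurable_pi_apply t).aemeasurable).1 (L.indepFun_history I ω t)
  rw [(I.measurePreserving_round t).map_eq] at hmap
  have : IsProbabilityMeasure (I.tableLaw.map fun ρ => L.history ω ρ t) :=
    Measure.isProbabilityMeasure_map hH.aemeasurable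
  have hint : Integrable (Function.uncurry G)
      ((I.tableLaw.map fun ρ => L.history ω ρ t).prod I.roundLaw) :=
    (hB.comp_snd _).mono' hG.aestronglyMeasurable (.of_forall fun q => hGB q.1 q.2)
  calc ∫ ρ, G (L.history ω ρ t) (ρ t) ∂I.tableLaw
      = ∫ q, Function.uncurry G q ∂(I.tableLaw.map fun ρ => (L.history ω ρ t, ρ t)) := by
        rw [integral_map (hH.prodMk (measurable_pi_apply t)).aemeasurable
          hG.aestronglyMeasurable]
        rfl
    _ = ∫ h, ∫ r, G h r ∂I.roundLaw ∂(I.tableLaw.map fun ρ => L.history ω ρ t) := by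
        rw [hmap, integral_prod _ hint]
        rfl
    _ = _ := by
        rw [integral_map hH.aemeasurable]
        exact hG.stronglyMeasurable.integral_prod_right.aestronglyMeasurable

/-! ### Regret as the expected total gap -/

/-- The expected loss of an action compared to the best assignment. -/
noncomputable def Instance.gap (I : Instance N K) (a : Action N K C) : ℝ :=
  ∑ i, ((⨆ j, I.mean i j) - I.mean i (a.arm i))

lemma Instance.mean_le_iSup (I : Instance N K) (i : Fin N) (j : Fin K) :
    I.mean i j ≤ ⨆ j, I.mean i j :=
  le_ciSup (Set.finite_range _).bddAbove j

lemma exists_abs_le_of_action (f : Action N K C → ℝ) : ∃ M, ∀ a, |f a| ≤ M := by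
  obtain ⟨M, hM⟩ := (Set.finite_range fun a => |f a|).bddAbove
  exact ⟨M, fun a => hM ⟨a, rfl⟩⟩

lemma Learner.measurable_reward (t : ℕ) (i : Fin N) :
    Measurable fun q : L.Seed × RewardTable N K => L.reward q.1 q.2 t i := by
  have h : Measurable fun q : Action N K C × (Fin N → Fin K → ℝ) => q.2 i (q.1.arm i) :=
    measurable_from_prod_countable_right fun a =>
      (measurable_pi_apply (a.arm i)).comp (measurable_pi_apply i)
  exact h.comp ((L.measurable_action t).prodMk ((measurable_pi_apply t).comp measurable_snd))

lemma abs_apply_le_sum (r : Fin N → Fin K → ℝ) (i : Fin N) (j : Fin K) :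
    |r i j| ≤ ∑ j, |r i j| :=
  Finset.single_le_sum (f := fun j => |r i j|) (fun _ _ => abs_nonneg _) (Finset.mem_univ j)

lemma Learner.integrable_reward (p : Fin N → Fin K → unitInterval) (t : ℕ) (i : Fin N) :
    Integrable (fun q : L.Seed × RewardTable N K => L.reward q.1 q.2 t i)
      (L.seedLaw.prod (bernoulliInstance p).tableLaw) := by
  have h := ((bernoulliInstance p).measurePreserving_round t).integrable_comp_of_integrable
    (integrable_roundLaw p fun r => ∑ j, |r i j|)
  exact (h.comp_snd _).mono' (L.measurable_reward t i).aestronglyMeasurable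
    (.of_forall fun q => abs_apply_le_sum (q.2 t) i _)

/-- The action of round `t` is fixed by the seed and the history, which are independent of that
round's rewards. The sum over arms serves as a dominating function free of the action. -/
lemma Learner.integral_reward (p : Fin N → Fin K → unitInterval) (ω : L.Seed) (t : ℕ)
    (i : Fin N) :
    ∫ ρ, L.reward ω ρ t i ∂(bernoulliInstance p).tableLaw =
      ∫ ρ, (bernoulliInstance p).mean i ((L.action ω ρ t).arm i)
        ∂(bernoulliInstance p).tableLaw := by
  have hG : Measurable (Function.uncurry fun (h : Fin t → Feedback N) (r : Fin N → Fin K → ℝ) =>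
      r i ((L.act t ω h).arm i)) := by
    have h : Measurable fun q : Action N K C × (Fin N → Fin K → ℝ) => q.2 i (q.1.arm i) :=
      measurable_from_prod_countable_right fun a =>
      (measurable_pi_apply (a.arm i)).comp (measurable_pi_apply i)
    exact h.comp ((((L.measurable_act t).comp measurable_prodMk_left).comp
      measurable_fst).prodMk measurable_snd)
  have := L.integral_history_round (bernoulliInstance p) ω t hG
    (integrable_roundLaw p fun r => ∑ j, |r i j|) fun h r => abs_apply_le_sum r i _
  simp only [integral_roundLaw_eval] at this
  exact this

lemma Learner.integrable_comp_action (I : Instance N K) (f : Action N K C → ℝ) (t : ℕ) :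
    Integrable (fun q : L.Seed × RewardTable N K => f (L.action q.1 q.2 t))
      (L.seedLaw.prod I.tableLaw) := by
  obtain ⟨M, hM⟩ := exists_abs_le_of_action f
  exact (integrable_const M).mono'
    ((measurable_of_finite f).comp (L.measurable_action t)).aestronglyMeasurable
    (.of_forall fun q => hM _)

lemma Learner.integrable_comp_action_right (I : Instance N K) (f : Action N K C → ℝ)
    (ω : L.Seed) (t : ℕ) : Integrable (fun ρ => f (L.action ω ρ t)) I.tableLaw := by
  obtain ⟨M, hM⟩ := exists_abs_le_of_action f
  exact (integrable_const M).mono' ((measurable_of_finite f).comp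
    ((L.measurable_action t).comp measurable_prodMk_left)).aestronglyMeasurable
    (.of_forall fun q => hM _)

lemma regret_eq_integral_gap (p : Fin N → Fin K → unitInterval) (T : ℕ) :
    regret L (bernoulliInstance p) T =
      ∫ ω, ∫ ρ, ∑ t ∈ Finset.range T, (bernoulliInstance p).gap (L.action ω ρ t)
        ∂(bernoulliInstance p).tableLaw ∂L.seedLaw := by
  set I := bernoulliInstance p
  have h1 : ∫ q : L.Seed × RewardTable N K, ∑ t ∈ Finset.range T, ∑ i, L.reward q.1 q.2 t i
      ∂(L.seedLaw.prod I.tableLaw) =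
      ∫ q : L.Seed × RewardTable N K, ∑ t ∈ Finset.range T,
        ∑ i, I.mean i ((L.action q.1 q.2 t).arm i) ∂(L.seedLaw.prod I.tableLaw) := by
    rw [integral_finsetSum _ fun t _ => integrable_finsetSum _ fun i _ =>
        L.integrable_reward p t i,
      integral_finsetSum _ fun t _ => integrable_finsetSum _ fun i _ =>
        L.integrable_comp_action I (fun a => I.mean i (a.arm i)) t]
    refine Finset.sum_congr rfl fun t _ => ?_
    rw [integral_finsetSum _ fun i _ => L.integrable_reward p t i,
      integral_finsetSum _ fun i _ =>
        L.integrable_comp_action I (fun a => I.mean i (a.arm i)) t]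
    refine Finset.sum_congr rfl fun i _ => ?_
    rw [integral_prod _ (L.integrable_reward p t i),
      integral_prod _ (L.integrable_comp_action I (fun a => I.mean i (a.arm i)) t)]
    exact integral_congr_ae (.of_forall fun ω => L.integral_reward p ω t i)
  have h2 : ∫ _ : L.Seed × RewardTable N K, (T : ℝ) * (∑ i, ⨆ j, I.mean i j)
      ∂(L.seedLaw.prod I.tableLaw) = (T : ℝ) * (∑ i, ⨆ j, I.mean i j) := by simp
  rw [regret, h1, ← h2, ← integral_sub (integrable_const _)
    (integrable_finsetSum _ fun t _ =>
      L.integrable_comp_action I (fun a => ∑ i, I.mean i (a.arm i)) t),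
    ← integral_prod _ (integrable_finsetSum _ fun t _ => L.integrable_comp_action I I.gap t)]
  refine integral_congr_ae (.of_forall fun q => ?_)
  simp [Instance.gap, Finset.sum_sub_distrib]

/-! ### The value recursion -/

/-- The expected total cost of the `n` rounds from round `t` on, for the seed `ω`, given the
history `h` of the first `t` rounds. -/
noncomputable def Learner.value (L : Learner N K C) (m : Fin N → Fin K → ℝ) (cost : Action N K C → ℝ)
    (ω : L.Seed) : (n t : ℕ) → (Fin t → Feedback N) → ℝ
  | 0, _, _ => 0
  | n + 1, t, h => cost (L.act t ω h) + ∑ U, weight m U *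
      L.value m cost ω n (t + 1)
        (Fin.snoc (α := fun _ => Feedback N) h ((L.act t ω h).observe (table U)))

variable (m : Fin N → Fin K → ℝ) (cost : Action N K C → ℝ)

lemma Learner.measurable_value (n t : ℕ) :
    Measurable fun q : L.Seed × (Fin t → Feedback N) => L.value m cost q.1 n t q.2 := by
  induction n generalizing t with
  | zero => exact measurable_const
  | succ n ih =>
    have hobs : ∀ U, Measurable fun q : L.Seed × (Fin t → Feedback N) =>
        (L.act t q.1 q.2).observe (table U) := fun U =>
      measurable_observe.comp ((L.measurable_act t).prodMk (measurable_const (a := table U)))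
    exact ((measurable_of_finite cost).comp (L.measurable_act t)).add
      (Finset.measurable_fun_sum _ fun U _ => ((ih (t + 1)).comp (measurable_fst.prodMk
        ((measurable_snoc t).comp (measurable_snd.prodMk (hobs U))))).const_mul _)

lemma Learner.exists_abs_value_le (n : ℕ) :
    ∃ M, ∀ ω t h, |L.value m cost ω n t h| ≤ M := by
  induction n with
  | zero => exact ⟨0, by simp [Learner.value]⟩
  | succ n ih =>
    obtain ⟨M, hM⟩ := ih
    obtain ⟨M', hM'⟩ := exists_abs_le_of_action cost
    refine ⟨M' + ∑ U, |weight m U| * M, fun ω t h => ?_⟩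
    refine (abs_add_le _ _).trans (add_le_add (hM' _) ?_)
    refine (Finset.abs_sum_le_sum_abs _ _).trans (Finset.sum_le_sum fun U _ => ?_)
    rw [abs_mul]
    exact mul_le_mul_of_nonneg_left (hM _ _ _) (abs_nonneg _)

lemma Learner.integrable_value (n t : ℕ) (h : Fin t → Feedback N) :
    Integrable (fun ω => L.value m cost ω n t h) L.seedLaw := by
  obtain ⟨M, hM⟩ := L.exists_abs_value_le m cost n
  exact (integrable_const M).mono' ((L.measurable_value m cost n t).comp
    measurable_prodMk_right).aestronglyMeasurable (.of_forall fun ω => hM ω t h)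

lemma Learner.integrable_value_history (I : Instance N K) (ω : L.Seed) (n t : ℕ) :
    Integrable (fun ρ => L.value m cost ω n t (L.history ω ρ t)) I.tableLaw := by
  obtain ⟨M, hM⟩ := L.exists_abs_value_le m cost n
  exact (integrable_const M).mono' ((L.measurable_value m cost n t).comp
    (measurable_const.prodMk (L.measurable_history_right ω t))).aestronglyMeasurable
    (.of_forall fun ρ => hM ω t _)

/-- Each unfolding of the recursion averages over one round's success patterns, which is what
`integral_history_round` allows. -/
lemma Learner.integral_value_history (p : Fin N → Fin K → unitInterval) (ω : L.Seed)
    (n t : ℕ) :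
    ∫ ρ, L.value (fun i j => (p i j : ℝ)) cost ω n t (L.history ω ρ t)
        ∂(bernoulliInstance p).tableLaw =
      ∫ ρ, ∑ s ∈ Finset.range n, cost (L.action ω ρ (t + s))
        ∂(bernoulliInstance p).tableLaw := by
  set I := bernoulliInstance p
  set m : Fin N → Fin K → ℝ := fun i j => p i j
  induction n generalizing t with
  | zero => simp [Learner.value]
  | succ n ih =>
    obtain ⟨M, hM⟩ := L.exists_abs_value_le m cost n
    let G : (Fin t → Feedback N) → (Fin N → Fin K → ℝ) → ℝ := fun h r =>
      L.value m cost ω n (t + 1)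
        (Fin.snoc (α := fun _ => Feedback N) h ((L.act t ω h).observe r))
    have hact : Measurable fun h => L.act t ω h := (L.measurable_act t).comp measurable_prodMk_left
    have hG : Measurable (Function.uncurry G) :=
      (L.measurable_value m cost n (t + 1)).comp (measurable_const.prodMk
        ((measurable_snoc t).comp (measurable_fst.prodMk (measurable_observe.comp
          ((hact.comp measurable_fst).prodMk measurable_snd)))))
    have key := L.integral_history_round I ω t hG (integrable_const M) fun h r => hM _ _ _
    have hsum : ∀ ρ, ∑ s ∈ Finset.range (n + 1), cost (L.action ω ρ (t + s)) =
        cost (L.action ω ρ t) + ∑ s ∈ Finset.range n, cost (L.action ω ρ (t + 1 + s)) := by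
      intro ρ
      rw [Finset.sum_range_succ', add_comm]
      simp only [add_zero, add_assoc, add_comm 1]
    have hval : ∀ ρ, L.value m cost ω (n + 1) t (L.history ω ρ t) =
        cost (L.action ω ρ t) + ∫ r, G (L.history ω ρ t) r ∂I.roundLaw := by
      intro ρ
      rw [integral_roundLaw]
      rfl
    -- Integrability comes from writing the inner integral as a difference of two bounded measurable
    -- functions.
    have hG' : Integrable (fun ρ => ∫ r, G (L.history ω ρ t) r ∂I.roundLaw) I.tableLaw := by
      refine (((L.integrable_value_history m cost I ω (n + 1) t)).sub
        (L.integrable_comp_action_right I cost ω t)).congr (.of_forall fun ρ => ?_)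
      simp [hval ρ]
    simp only [hsum, hval]
    rw [integral_add (L.integrable_comp_action_right I cost ω t) hG',
      integral_add (L.integrable_comp_action_right I cost ω t)
        (integrable_finsetSum _ fun s _ => L.integrable_comp_action_right I cost ω _),
      ← ih (t + 1), ← key]
    rfl

lemma regret_eq_integral_value (p : Fin N → Fin K → unitInterval) (T : ℕ) :
    regret L (bernoulliInstance p) T =
      ∫ ω, L.value (fun i j => (p i j : ℝ)) (bernoulliInstance p).gap ω T 0 Fin.elim0
        ∂L.seedLaw := by
  rw [regret_eq_integral_gap]
  refine integral_congr_ae (.of_forall fun ω => ?_)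
  have h := L.integral_value_history (bernoulliInstance p).gap p ω T 0
  simp only [zero_add] at h
  dsimp only
  rw [← h]
  simp [Learner.history]

end

end AnonymousBandit

namespace AnonymousBandit

/-! ### The two instances -/

/-- The mean rewards of the hard instance: rows are users, columns are arms. -/
noncomputable def hardMean (ε : ℝ) : Fin 3 → Fin 3 → ℝ :=
  ![![1 / 2 + ε, 1 / 2, 0], ![1 / 2 - ε, 1 / 2, 0], ![0, 0, 1]]

lemma hardMean_mem {ε : ℝ} (h : |ε| ≤ 1 / 2) (i j : Fin 3) :
    hardMean ε i j ∈ unitInterval := by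
  obtain ⟨h1, h2⟩ := abs_le.1 h
  fin_cases i <;> fin_cases j <;> norm_num [hardMean] <;> constructor <;> linarith

/-- The hard instance with gap `ε`. -/
noncomputable def hardInstance (ε : ℝ) (h : |ε| ≤ 1 / 2) : Instance 3 3 :=
  bernoulliInstance fun i j => ⟨hardMean ε i j, hardMean_mem h i j⟩

lemma mean_hardInstance {ε : ℝ} (h : |ε| ≤ 1 / 2) (i j : Fin 3) :
    (hardInstance ε h).mean i j = hardMean ε i j :=
  mean_bernoulliInstance _ i j

/-- Exchanging the outcomes of the first two users on the first arm. -/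
def swapOutcome (U : Fin 3 → Fin 3 → Bool) : Fin 3 → Fin 3 → Bool :=
  ![![U 1 0, U 0 1, U 0 2], ![U 0 0, U 1 1, U 1 2], U 2]

lemma swapOutcome_involutive : Function.Involutive swapOutcome := by
  intro U
  funext i j
  fin_cases i <;> fin_cases j <;> rfl

/-- Changing the sign of `ε` exchanges the arm 0 means of users 0 and 1 and leaves all other means
alone. -/
lemma weight_neg_swapOutcome (ε : ℝ) (U : Fin 3 → Fin 3 → Bool) :
    weight (hardMean (-ε)) (swapOutcome U) = weight (hardMean ε) U := by
  simp only [weight, Fin.prod_univ_three]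
  rw [show swapOutcome U 0 0 = U 1 0 from rfl, show swapOutcome U 0 1 = U 0 1 from rfl,
    show swapOutcome U 0 2 = U 0 2 from rfl, show swapOutcome U 1 0 = U 0 0 from rfl,
    show swapOutcome U 1 1 = U 1 1 from rfl, show swapOutcome U 1 2 = U 1 2 from rfl,
    show swapOutcome U 2 = U 2 from rfl]
  simp only [hardMean, Matrix.cons_val_zero, Matrix.cons_val_one, Matrix.cons_val]
  rcases (U 0 0).eq_false_or_eq_true with h0 | h0 <;>
  rcases (U 1 0).eq_false_or_eq_true with h1 | h1 <;>
  simp only [h0, h1, if_true, if_false, Bool.false_eq_true] <;> ring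

/-- On arm 0, users 0 and 1 each contribute `(1/2 + ε) * (1/2 - ε)` whatever the outcome. The
product is thus a perfect square, and the Hellinger affinity of the two round laws is exactly `1 - 4
* ε ^ 2`. -/
lemma weight_mul_weight_neg (ε : ℝ) (U : Fin 3 → Fin 3 → Bool) :
    weight (hardMean ε) U * weight (hardMean (-ε)) U =
      ((1 - 4 * ε ^ 2) * weight (hardMean 0) U) ^ 2 := by
  simp only [weight, Fin.prod_univ_three, hardMean, Matrix.cons_val_zero,
    Matrix.cons_val_one, Matrix.cons_val]
  cases U 0 0 <;> cases U 1 0 <;> simp only [if_true, if_false, Bool.false_eq_true] <;> ring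

lemma weight_hardMean_nonneg {ε : ℝ} (h : |ε| ≤ 1 / 2) (U : Fin 3 → Fin 3 → Bool) :
    0 ≤ weight (hardMean ε) U :=
  weight_nonneg (fun i j => ⟨hardMean ε i j, hardMean_mem h i j⟩) U

lemma sum_weight_hardMean {ε : ℝ} (h : |ε| ≤ 1 / 2) : ∑ U, weight (hardMean ε) U = 1 :=
  sum_weight fun i j => ⟨hardMean ε i j, hardMean_mem h i j⟩

lemma sqrt_weight_mul_weight_neg {ε : ℝ} (h : |ε| ≤ 1 / 2) (U : Fin 3 → Fin 3 → Bool) :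
    √(weight (hardMean ε) U * weight (hardMean (-ε)) U) =
      (1 - 4 * ε ^ 2) * weight (hardMean 0) U := by
  rw [weight_mul_weight_neg, Real.sqrt_sq]
  refine mul_nonneg ?_ (weight_hardMean_nonneg (by simp) U)
  obtain ⟨h1, h2⟩ := abs_le.1 h
  nlinarith

/-- Unless the last user plays the first arm, the two instances cannot be told apart. -/
lemma observe_table_swapOutcome (a : Action 3 3 2) (h : a.arm 2 ≠ 0)
    (U : Fin 3 → Fin 3 → Bool) :
    a.observe (table (swapOutcome U)) = a.observe (table U) := by
  funext G
  unfold Action.observe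
  split_ifs with hG
  swap
  · rfl
  have key : ∀ i, a.arm i ≠ 0 ∨ i = 2 →
      table (swapOutcome U) i (a.arm i) = table U i (a.arm i) := by
    intro i
    generalize a.arm i = j
    fin_cases i <;> fin_cases j <;> simp [table, swapOutcome]
  have hcard := a.le_card G hG
  have hsame := a.same_arm G hG
  by_cases h0 : ∃ i ∈ G, a.arm i = 0
  · obtain ⟨i, hi, hi0⟩ := h0
    have hall : ∀ k ∈ G, a.arm k = 0 := fun k hk => (hsame k hk i hi).trans hi0
    -- A group on arm 0 omits user 2, so its size forces it to be `{0, 1}`, whose total is symmetric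
    -- under the swap.
    have hsub : G ⊆ {0, 1} := by
      intro k hk
      have hk2 : k ≠ 2 := fun hk2 => h (hk2 ▸ hall k hk)
      fin_cases k <;> simp_all
    have hGe : G = {0, 1} := Finset.eq_of_subset_of_card_le hsub (by simpa using hcard)
    subst hGe
    rw [Finset.sum_pair (by decide), Finset.sum_pair (by decide), hall 0 (by simp),
      hall 1 (by simp), add_comm]
    rfl
  · push Not at h0
    exact Finset.sum_congr rfl fun i hi => key i (.inl (h0 i hi))

lemma sum_weight_neg_comp_observe (ε : ℝ) (a : Action 3 3 2) (h : a.arm 2 ≠ 0)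
    (F : Feedback 3 → ℝ) :
    ∑ U, weight (hardMean (-ε)) U * F (a.observe (table U)) =
      ∑ U, weight (hardMean ε) U * F (a.observe (table U)) := by
  rw [← Equiv.sum_comp swapOutcome_involutive.toPerm]
  refine Finset.sum_congr rfl fun U _ => ?_
  rw [Function.Involutive.coe_toPerm, weight_neg_swapOutcome, observe_table_swapOutcome a h]

lemma le_gap (I : Instance 3 3) (a : Action 3 3 2) (i j : Fin 3) :
    I.mean i j - I.mean i (a.arm i) ≤ I.gap a :=
  (sub_le_sub_right (I.mean_le_iSup i j) _).trans
    (Finset.single_le_sum (f := fun i => (⨆ j, I.mean i j) - I.mean i (a.arm i))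
      (fun i _ => sub_nonneg.2 (I.mean_le_iSup i _)) (Finset.mem_univ i))

lemma gap_nonneg (I : Instance 3 3) (a : Action 3 3 2) : 0 ≤ I.gap a := by
  simpa using le_gap I a 0 (a.arm 0)

lemma one_le_gap {ε : ℝ} (h : |ε| ≤ 1 / 2) (a : Action 3 3 2) (ha : a.arm 2 = 0) :
    1 ≤ (hardInstance ε h).gap a := by
  have := le_gap (hardInstance ε h) a 2 2
  rw [mean_hardInstance, mean_hardInstance, ha] at this
  simpa [hardMean] using this

/-- With `le_gap_neg_of_arm_eq`: whichever arm user 0 plays, one of the two signs charges `ε`. -/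
lemma le_gap_of_arm_ne {ε : ℝ} (h : |ε| ≤ 1 / 2) (a : Action 3 3 2) (ha : a.arm 0 ≠ 0) :
    ε ≤ (hardInstance ε h).gap a := by
  have := le_gap (hardInstance ε h) a 0 0
  rw [mean_hardInstance, mean_hardInstance] at this
  refine le_trans ?_ this
  obtain ⟨h1, h2⟩ := abs_le.1 h
  generalize a.arm 0 = j at ha
  fin_cases j <;> simp [hardMean] at ha ⊢

lemma le_gap_neg_of_arm_eq {ε : ℝ} (h : |-ε| ≤ 1 / 2) (a : Action 3 3 2) (ha : a.arm 0 = 0) :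
    ε ≤ (hardInstance (-ε) h).gap a := by
  have := le_gap (hardInstance (-ε) h) a 0 1
  rw [mean_hardInstance, mean_hardInstance, ha] at this
  refine le_trans ?_ this
  simp [hardMean]

/-! ### The potential argument -/

/-- By AM-GM, `√(x * y) ≤ x + y / 4`. The bare `√(a * b)` can exceed `min a b`, hence the linear
correction; being linear, it is preserved when averaging over outcomes. -/
lemma sqrt_mul_sub_le_min {a b : ℝ} (ha : 0 ≤ a) (hb : 0 ≤ b) :
    √(a * b) - (a + b) / 4 ≤ min a b := by
  have h : ∀ {x y : ℝ}, 0 ≤ x → x ≤ y → √(x * y) - (x + y) / 4 ≤ x := by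
    intro x y hx hxy
    have hs : √(x * y) ≤ x + y / 4 :=
      Real.sqrt_le_iff.2 ⟨by linarith, by nlinarith [sq_nonneg (x - y / 4)]⟩
    linarith
  rcases le_total a b with hab | hab
  · rw [min_eq_left hab]
    exact h ha hab
  · rw [min_eq_right hab, mul_comm, add_comm]
    exact h hb hab

lemma sqrt_mul_le_half_add {a b : ℝ} (ha : 0 ≤ a) (hb : 0 ≤ b) : √(a * b) ≤ (a + b) / 2 :=
  Real.sqrt_le_iff.2 ⟨by linarith, by nlinarith [sq_nonneg (a - b)]⟩

lemma le_value_add_value (L : Learner 3 3 2) (ω : L.Seed) {ε : ℝ} (h : |ε| ≤ 1 / 2)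
    (h' : |-ε| ≤ 1 / 2) (hε : 0 ≤ ε) (n : ℕ) (hn : n * ε ^ 3 ≤ 1 / 4) (t : ℕ)
    (H : Fin t → Feedback 3) {a b : ℝ} (ha : 0 ≤ a) (hb : 0 ≤ b) :
    n * ε * (√(a * b) - (a + b) / 4) ≤
      a * L.value (hardMean ε) (hardInstance ε h).gap ω n t H +
      b * L.value (hardMean (-ε)) (hardInstance (-ε) h').gap ω n t H := by
  induction n generalizing t a b with
  | zero => simp [Learner.value]
  | succ n ih =>
    have hε3 : 0 ≤ ε ^ 3 := pow_nonneg hε 3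
    push_cast at hn ⊢
    specialize ih (by nlinarith)
    simp only [Learner.value]
    set x := L.act t ω H
    set F₀ : Feedback 3 → ℝ := fun y => L.value (hardMean ε) (hardInstance ε h).gap ω n (t + 1)
      (Fin.snoc (α := fun _ => Feedback 3) H y)
    set F₁ : Feedback 3 → ℝ := fun y => L.value (hardMean (-ε)) (hardInstance (-ε) h').gap ω n
      (t + 1) (Fin.snoc (α := fun _ => Feedback 3) H y)
    change _ ≤ a * (_ + ∑ U, weight (hardMean ε) U * F₀ (x.observe (table U))) +
      b * (_ + ∑ U, weight (hardMean (-ε)) U * F₁ (x.observe (table U)))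
    have ih' : ∀ y {a b : ℝ}, 0 ≤ a → 0 ≤ b →
        n * ε * (√(a * b) - (a + b) / 4) ≤ a * F₀ y + b * F₁ y :=
      fun y a b ha hb => ih (t + 1) _ ha hb
    clear_value F₀ F₁
    set g₀ := (hardInstance ε h).gap x
    set g₁ := (hardInstance (-ε) h').gap x
    have hg₀0 : 0 ≤ g₀ := gap_nonneg _ _
    have hg₁0 : 0 ≤ g₁ := gap_nonneg _ _
    by_cases hx : x.arm 2 = 0
    · have h1 : 1 ≤ g₀ := one_le_gap h x hx
      have h2 : 1 ≤ g₁ := one_le_gap h' x hx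
      have hsum : n * ε * (√(a * b) * (1 - 4 * ε ^ 2) - (a + b) / 4) ≤
          a * ∑ U, weight (hardMean ε) U * F₀ (x.observe (table U)) +
          b * ∑ U, weight (hardMean (-ε)) U * F₁ (x.observe (table U)) := by
        rw [Finset.mul_sum, Finset.mul_sum, ← Finset.sum_add_distrib]
        -- The induction hypothesis is applied to each full success pattern, with `a` and `b`
        -- multiplied by its likelihoods, as if the learner saw every reward.
        have hU : ∀ U, n * ε * (√(a * b) * ((1 - 4 * ε ^ 2) * weight (hardMean 0) U) -
            (a * weight (hardMean ε) U + b * weight (hardMean (-ε)) U) / 4) ≤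
            a * (weight (hardMean ε) U * F₀ (x.observe (table U))) +
            b * (weight (hardMean (-ε)) U * F₁ (x.observe (table U))) := by
          intro U
          have := ih' (x.observe (table U)) (mul_nonneg ha (weight_hardMean_nonneg h U))
            (mul_nonneg hb (weight_hardMean_nonneg h' U))
          rw [mul_mul_mul_comm, Real.sqrt_mul (mul_nonneg ha hb),
            sqrt_weight_mul_weight_neg h] at this
          linarith
        refine le_trans (le_of_eq ?_) (Finset.sum_le_sum fun U _ => hU U)
        rw [← Finset.mul_sum, Finset.sum_sub_distrib, ← Finset.mul_sum, ← Finset.mul_sum,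
          ← Finset.sum_div, Finset.sum_add_distrib, ← Finset.mul_sum, ← Finset.mul_sum,
          sum_weight_hardMean h, sum_weight_hardMean h', sum_weight_hardMean (by simp)]
        ring
      have hs := sqrt_mul_le_half_add ha hb
      have hs0 := Real.sqrt_nonneg (a * b)
      have hε2 : ε ≤ 1 / 2 := (le_abs_self ε).trans h
      have e1 : a ≤ a * g₀ := le_mul_of_one_le_right ha h1
      have e2 : b ≤ b * g₁ := le_mul_of_one_le_right hb h2
      -- The potential grows by at most `ε * √(a * b) + 4 * n * ε ^ 3 * √(a * b) ≤ 3/2 * √(a * b)`,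
      -- which is at most the cost `a + b`.
      have e3 : n * ε ^ 3 * √(a * b) ≤ 1 / 4 * √(a * b) :=
        mul_le_mul_of_nonneg_right (by linarith) hs0
      have e4 : ε * √(a * b) ≤ 1 / 2 * √(a * b) := mul_le_mul_of_nonneg_right hε2 hs0
      have e5 : 0 ≤ ε * (a + b) := mul_nonneg hε (add_nonneg ha hb)
      linarith
    · have hmin : ε * min a b ≤ a * g₀ + b * g₁ := by
        by_cases hx0 : x.arm 0 = 0
        · have h2 : ε ≤ g₁ := le_gap_neg_of_arm_eq h' x hx0
          have := mul_le_mul (min_le_right a b) h2 hε hb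
          nlinarith [mul_nonneg ha hg₀0]
        · have h2 : ε ≤ g₀ := le_gap_of_arm_ne h x hx0
          have := mul_le_mul (min_le_left a b) h2 hε ha
          nlinarith [mul_nonneg hb hg₁0]
      -- Both future values are averaged under the same law, so the induction hypothesis is used
      -- with `a` and `b` unchanged.
      have hsum : n * ε * (√(a * b) - (a + b) / 4) ≤
          a * ∑ U, weight (hardMean ε) U * F₀ (x.observe (table U)) +
          b * ∑ U, weight (hardMean ε) U * F₁ (x.observe (table U)) := by
        rw [Finset.mul_sum, Finset.mul_sum, ← Finset.sum_add_distrib]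
        have hU : ∀ U, weight (hardMean ε) U * (n * ε * (√(a * b) - (a + b) / 4)) ≤
            a * (weight (hardMean ε) U * F₀ (x.observe (table U))) +
            b * (weight (hardMean ε) U * F₁ (x.observe (table U))) := by
          intro U
          have := mul_le_mul_of_nonneg_left (ih' (x.observe (table U)) ha hb)
            (weight_hardMean_nonneg h U)
          linarith
        refine le_trans (le_of_eq ?_) (Finset.sum_le_sum fun U _ => hU U)
        rw [← Finset.sum_mul, sum_weight_hardMean h, one_mul]
      rw [sum_weight_neg_comp_observe ε x hx]
      have := mul_le_mul_of_nonneg_left (sqrt_mul_sub_le_min ha hb) hε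
      linarith

lemma le_regret_add_regret (L : Learner 3 3 2) {ε : ℝ} (h : |ε| ≤ 1 / 2)
    (h' : |-ε| ≤ 1 / 2) (hε : 0 ≤ ε) (T : ℕ) (hT : T * ε ^ 3 ≤ 1 / 4) :
    T * ε / 2 ≤ regret L (hardInstance ε h) T + regret L (hardInstance (-ε) h') T := by
  have key : ∀ ω, T * ε / 2 ≤
      L.value (hardMean ε) (hardInstance ε h).gap ω T 0 Fin.elim0 +
      L.value (hardMean (-ε)) (hardInstance (-ε) h').gap ω T 0 Fin.elim0 := by
    intro ω
    -- At `a = b = 1` the bracket equals `1 - 2 / 4 = 1 / 2`.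
    have := le_value_add_value L ω h h' hε T hT 0 Fin.elim0 zero_le_one zero_le_one
    norm_num at this
    linarith
  calc T * ε / 2 = ∫ _, T * ε / 2 ∂L.seedLaw := by simp
    _ ≤ ∫ ω, (L.value (hardMean ε) (hardInstance ε h).gap ω T 0 Fin.elim0 +
      L.value (hardMean (-ε)) (hardInstance (-ε) h').gap ω T 0 Fin.elim0) ∂L.seedLaw :=
        integral_mono (integrable_const _)
          ((L.integrable_value _ _ T 0 _).add (L.integrable_value _ _ T 0 _)) key
    _ = _ := by
        rw [integral_add (L.integrable_value _ _ T 0 _) (L.integrable_value _ _ T 0 _)]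
        exact congrArg₂ (· + ·)
          (regret_eq_integral_value L (fun i j => ⟨hardMean ε i j, hardMean_mem h i j⟩) T).symm
          (regret_eq_integral_value L (fun i j => ⟨hardMean (-ε) i j, hardMean_mem h' i j⟩) T).symm

end AnonymousBandit

theorem theorem4 :
    ∃ c : ℝ, 0 < c ∧ ∀ T : ℕ, 1 ≤ T →
      ∃ I : Fin 2 → AnonymousBandit.Instance 3 3,
        (∀ x i j, ∃ p : unitInterval,
          (I x).law i j = ProbabilityTheory.bernoulliMeasure (1 : ℝ) 0 p) ∧
        ∀ L : AnonymousBandit.Learner 3 3 2,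
          c * (T : ℝ) ^ (2 / 3 : ℝ) ≤
            (AnonymousBandit.regret L (I 0) T + AnonymousBandit.regret L (I 1) T) / 2 := by
  refine ⟨1 / 16, by norm_num, fun T hT => ?_⟩
  have hT1 : (1 : ℝ) ≤ T := by exact_mod_cast hT
  have hT0 : (0 : ℝ) < T := by linarith
  -- The factor `1/4` keeps `ε ≤ 1/2` and gives `T * ε ^ 3 = 1/64`. Half of `T * ε / 2` is then `T ^
  -- (2/3) / 16`, whence the constant.
  set ε : ℝ := (T : ℝ) ^ (-1 / 3 : ℝ) / 4 with hεdef
  have hε0 : 0 ≤ ε := by positivity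
  have hε1 : (T : ℝ) ^ (-1 / 3 : ℝ) ≤ 1 := Real.rpow_le_one_of_one_le_of_nonpos hT1 (by norm_num)
  have h : |ε| ≤ 1 / 2 := by
    rw [abs_of_nonneg hε0]
    linarith
  have h' : |-ε| ≤ 1 / 2 := by rwa [abs_neg]
  have hcube : T * ε ^ 3 ≤ 1 / 4 := by
    have : ((T : ℝ) ^ (-1 / 3 : ℝ)) ^ 3 = (T : ℝ)⁻¹ := by
      rw [← Real.rpow_natCast, ← Real.rpow_mul hT0.le, ← Real.rpow_neg_one]
      norm_num
    rw [hεdef, div_pow, this, ← mul_div_assoc, mul_inv_cancel₀ hT0.ne']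
    norm_num
  have hpow : (T : ℝ) ^ (2 / 3 : ℝ) = 4 * (T * ε) := by
    rw [hεdef, show (2 / 3 : ℝ) = 1 + -1 / 3 by norm_num, Real.rpow_add hT0, Real.rpow_one]
    ring
  refine ⟨![AnonymousBandit.hardInstance ε h, AnonymousBandit.hardInstance (-ε) h'],
    fun x i j => ?_, fun L => ?_⟩
  · fin_cases x <;> exact ⟨_, rfl⟩
  · have := AnonymousBandit.le_regret_add_regret L h h' hε0 T hcube
    rw [hpow]
    simp only [Matrix.cons_val_zero, Matrix.cons_val_one]
    linarith
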